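/- Let $\mathsf h$ be a separable complex Hilbert space, $L_1(\cdot)$ the trace-class operators, and let $\mathsf F$ be the flip on the Hilbert space tensor product $\mathsf h\otimes\mathsf h$, $\mathsf F(u\otimes v)=v\otimes u$. (1) Let $x\in L_1(\mathsf h\otimes\mathsf h)$ be strictly positive (that is, $x\ge 0$ and $\langle u,xu\rangle>0$ for all $u\neq 0$), and let $\log x$ be the (possibly unbounded) self-adjoint operator $\sum_\mu(\log\mu)P_\mu$ with its natural domain, where $x=\sum_\mu\mu P_\mu$ is the spectral decomposition of $x$. Then $\mathsf Fx\mathsf F$ is again a strictly positive trace-class operator, so that $\log(\mathsf Fx\mathsf F)$ is a well-defined self-adjoint operator, and $\log(\mathsf Fx\mathsf F)=\mathsf F(\log x)\mathsf F$, with equality of domains. (2) Let $\{e_i\}_i$ be an orthonormal basis of $\mathsf h$, let $\theta$ be the anti-unitary conjugation with respect to it ($\theta e_i=e_i$ for all $i$), put $\Theta(x)=\theta x^*\theta$, and let $\rho$ be a state (a positive operator of trace one) that commutes with $\theta$ (for instance, $\{e_i\}_i$ diagonalizes $\rho$). For a bounded completely positive map $\Phi_*$ on $L_1(\mathsf h)$,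 the $\rho$-Choi-Jamiołkowski operator $\mathcal J_\rho(\Phi_*)=(1\otimes\Phi_*)(\omega_\rho)$ is the unique bounded operator on $\mathsf h\otimes\mathsf h$ with $$\langle e_k\otimes e_l,\ \mathcal J_\rho(\Phi_*)\,e_{k'}\otimes e_{l'}\rangle=\big\langle e_l,\ \Phi_*\big(|\rho^{1/2}e_k\rangle\langle\rho^{1/2}e_{k'}|\big)e_{l'}\big\rangle\qquad\text{for all }k,l,k',l'.$$ Let $\Phi_*$ and $\Phi_*^\Theta$ be bounded completely positive maps on $L_1(\mathsf h)$ whose dual maps $\Phi$ and $\Phi^\Theta$ on $\mathcal B(\mathsf h)$ (given by $\mathrm{tr}(\Phi_*(x)y)=\mathrm{tr}(x\Phi(y))$, and likewise for $\Phi^\Theta$) satisfy the $\Theta$-KMS duality $$\mathrm{tr}\big(\rho^{1/2}\Theta(x^*)\rho^{1/2}\Phi(y)\big)=\mathrm{tr}\big(\rho^{1/2}\Theta(\Phi^\Theta(x^*))\rho^{1/2}y\big)\qquad\text{for all }x,y\in\mathcal B(\mathsf h);$$ that is, $\Phi_*^\Theta$ is the predual of a $\Theta$-KMS adjoint of $\Phi$.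 Then the operators $\mathcal J_\rho(\Phi_*)$ and $\mathcal J_\rho(\Phi_*^\Theta)$ exist, and $$\mathcal J_\rho(\Phi_*^\Theta)=\mathsf F\,\mathcal J_\rho(\Phi_*)\,\mathsf F .$$ -/

import Mathlib

open scoped InnerProductSpace TensorProduct ENNReal ComplexOrder

namespace ChoiFlip

noncomputable section

/-! ### Trace-class operators -/

section TraceClass

variable (H : Type*) [NormedAddCommGroup H] [InnerProductSpace ℂ H] [CompleteSpace H]

/-- Index set of a fixed reference orthonormal (Hilbert) basis of `H`. -/
def stdIdx : Set H := (exists_hilbertBasis ℂ H).choose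

/-- A fixed reference orthonormal (Hilbert) basis of `H`, used to evaluate traces. -/
def stdBasis : HilbertBasis (stdIdx H) ℂ H := (exists_hilbertBasis ℂ H).choose_spec.choose

variable {H}

/-- The trace norm `‖T‖₁ = tr |T|`, where `|T| = (T* T)^{1/2}`, with values in `[0, ∞]`. -/
def traceNorm (T : H →L[ℂ] H) : ℝ≥0∞ :=
  ∑' i, ENNReal.ofReal (RCLike.re ⟪stdBasis H i, CFC.abs T (stdBasis H i)⟫_ℂ)

/-- `T` is trace class: `tr |T| < ∞`. -/
def IsTraceClass (T : H →L[ℂ] H) : Prop := traceNorm T < ⊤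

/-- The trace `tr T = ∑ ⟨b_i, T b_i⟩` (absolutely convergent and independent of the basis for
trace-class `T`). -/
def trace (T : H →L[ℂ] H) : ℂ := ∑' i, ⟪stdBasis H i, T (stdBasis H i)⟫_ℂ

theorem tsum_sq_basis (v : H) : ∑' i, ‖⟪stdBasis H i, v⟫_ℂ‖ₑ ^ 2 = ‖v‖ₑ ^ 2 := by
  have h := (stdBasis H).hasSum_inner_mul_inner v v
  have h2 : HasSum (fun i => ‖⟪stdBasis H i, v⟫_ℂ‖ ^ 2) (‖v‖ ^ 2) := by
    have h3 := RCLike.hasSum_re ℂ h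
    convert h3 using 1
    · funext i
      rw [← inner_conj_symm v, RCLike.conj_mul]
      norm_cast
    · rw [inner_self_eq_norm_sq]
  have h4 : ∀ x : H, ‖x‖ₑ ^ 2 = ENNReal.ofReal (‖x‖ ^ 2) := fun x => by
    rw [← ofReal_norm, ENNReal.ofReal_pow (norm_nonneg _)]
  have h5 : ∀ x : ℂ, ‖x‖ₑ ^ 2 = ENNReal.ofReal (‖x‖ ^ 2) := fun x => by
    rw [← ofReal_norm, ENNReal.ofReal_pow (norm_nonneg _)]
  simp only [h4, h5]
  rw [← h2.tsum_eq, ENNReal.ofReal_tsum_of_nonneg (fun _ => by positivity) h2.summable]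

/-- The squared Hilbert-Schmidt norm. -/
def hsSq (A : H →L[ℂ] H) : ℝ≥0∞ := ∑' i, ‖A (stdBasis H i)‖ₑ ^ 2

theorem hsSq_adjoint (A : H →L[ℂ] H) : hsSq (star A) = hsSq A := by
  unfold hsSq
  simp_rw [← tsum_sq_basis (H := H) ((star A) _), ← tsum_sq_basis (H := H) (A _)]
  rw [ENNReal.tsum_comm]
  refine tsum_congr fun i => tsum_congr fun j => ?_
  rw [ContinuousLinearMap.star_eq_adjoint, ContinuousLinearMap.adjoint_inner_right,
    ← inner_conj_symm, ← ofReal_norm, ← ofReal_norm, RCLike.norm_conj]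

theorem hsSq_mul_le (B A : H →L[ℂ] H) : hsSq (B * A) ≤ ‖B‖ₑ ^ 2 * hsSq A := by
  unfold hsSq
  rw [← ENNReal.tsum_mul_left]
  refine ENNReal.tsum_le_tsum fun i => ?_
  rw [← mul_pow]
  gcongr
  exact B.le_opENorm _

theorem traceNorm_eq_hsSq (T : H →L[ℂ] H) : traceNorm T = hsSq (CFC.sqrt (CFC.abs T)) := by
  unfold traceNorm hsSq
  refine tsum_congr fun i => ?_
  have hs : star (CFC.sqrt (CFC.abs T)) = CFC.sqrt (CFC.abs T) :=
    (IsSelfAdjoint.of_nonneg (CFC.sqrt_nonneg (CFC.abs T))).star_eq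
  have hm : CFC.sqrt (CFC.abs T) * CFC.sqrt (CFC.abs T) = CFC.abs T :=
    CFC.sqrt_mul_sqrt_self _ (CFC.abs_nonneg T)
  conv_lhs => rw [← hm]
  rw [mul_apply_eq_comp, ← ContinuousLinearMap.adjoint_inner_left,
    ← ContinuousLinearMap.star_eq_adjoint, hs, inner_self_eq_norm_sq,
    ENNReal.ofReal_pow (norm_nonneg _), ofReal_norm]

theorem norm_abs_apply (T : H →L[ℂ] H) (v : H) : ‖CFC.abs T v‖ = ‖T v‖ := by
  have hs : star (CFC.abs T) = CFC.abs T := (IsSelfAdjoint.of_nonneg (CFC.abs_nonneg T)).star_eq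
  have h : ⟪CFC.abs T v, CFC.abs T v⟫_ℂ = ⟪T v, T v⟫_ℂ := by
    rw [← ContinuousLinearMap.adjoint_inner_right, ← ContinuousLinearMap.star_eq_adjoint, hs,
      ← mul_apply_eq_comp, CFC.abs_mul_abs, mul_apply_eq_comp,
      ContinuousLinearMap.star_eq_adjoint, ContinuousLinearMap.adjoint_inner_right]
  rw [inner_self_eq_norm_sq_to_K, inner_self_eq_norm_sq_to_K] at h
  have h' : ‖CFC.abs T v‖ ^ 2 = ‖T v‖ ^ 2 := by exact_mod_cast h
  exact (sq_eq_sq₀ (norm_nonneg _) (norm_nonneg _)).mp h'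

/-- If `‖A v‖ = ‖B v‖` for all `v` then `B` factors through `A`. -/
theorem exists_factor (A B : H →L[ℂ] H) (h : ∀ v, ‖B v‖ = ‖A v‖) :
    ∃ W : H →L[ℂ] H, W * A = B := by
  let K : Submodule ℂ H := (LinearMap.range A.toLinearMap).topologicalClosure
  have hK : ∀ v, A v ∈ K := fun v => Submodule.le_topologicalClosure _ ⟨v, rfl⟩
  have : CompleteSpace K := (Submodule.isClosed_topologicalClosure _).completeSpace_coe
  let e : H →ₗ[ℂ] K := A.toLinearMap.codRestrict K hK
  have hd : DenseRange e := by
    intro x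
    rw [Metric.mem_closure_iff]
    intro ε hε
    have hx : (x : H) ∈ closure (LinearMap.range A.toLinearMap : Set H) := x.2
    obtain ⟨_, ⟨v, rfl⟩, hv⟩ := Metric.mem_closure_iff.mp hx ε hε
    exact ⟨e v, ⟨v, rfl⟩, hv⟩
  let W0 : K →L[ℂ] H := B.toLinearMap.extendOfNorm e
  have hW0 : ∀ v, W0 (e v) = B v :=
    LinearMap.extendOfNorm_eq hd ⟨1, fun v => by rw [one_mul]; exact (h v).le⟩
  refine ⟨W0 ∘L K.orthogonalProjectionOnto, ?_⟩
  ext v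
  have : K.orthogonalProjectionOnto (A v) = e v :=
    Submodule.orthogonalProjectionOnto_mem_subspace_eq_self (K := K) (e v)
  simp [this, hW0]

theorem exists_polar (T : H →L[ℂ] H) : ∃ U : H →L[ℂ] H, U * CFC.abs T = T :=
  exists_factor _ _ fun v => (norm_abs_apply T v).symm

theorem exists_abs_eq (T : H →L[ℂ] H) : ∃ V : H →L[ℂ] H, V * T = CFC.abs T :=
  exists_factor _ _ fun v => norm_abs_apply T v

theorem enorm_inner_le (x y : H) : ‖⟪x, y⟫_ℂ‖ₑ ≤ ‖x‖ₑ ^ 2 + ‖y‖ₑ ^ 2 := by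
  rw [← ofReal_norm, ← ofReal_norm, ← ofReal_norm,
    ← ENNReal.ofReal_pow (norm_nonneg _), ← ENNReal.ofReal_pow (norm_nonneg _),
    ← ENNReal.ofReal_add (by positivity) (by positivity)]
  refine ENNReal.ofReal_le_ofReal ((norm_inner_le_norm x y).trans ?_)
  nlinarith [sq_nonneg (‖x‖ - ‖y‖), sq_nonneg (‖x‖ + ‖y‖)]

theorem isTraceClass_iff (T : H →L[ℂ] H) :
    IsTraceClass T ↔
      ∀ W : H →L[ℂ] H, ∑' i, ‖⟪stdBasis H i, W (T (stdBasis H i))⟫_ℂ‖ₑ < ⊤ := by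
  constructor
  · intro hT W
    obtain ⟨U, hU⟩ := exists_polar T
    set S := CFC.sqrt (CFC.abs T) with hS
    have hm : S * S = CFC.abs T := CFC.sqrt_mul_sqrt_self _ (CFC.abs_nonneg T)
    have hfin : hsSq S < ⊤ := by rw [hS, ← traceNorm_eq_hsSq]; exact hT
    have h1 : ∀ v, W (T v) = (W * U * S) (S v) := fun v => by
      conv_lhs => rw [← hU, ← hm]
      rfl
    calc ∑' i, ‖⟪stdBasis H i, W (T (stdBasis H i))⟫_ℂ‖ₑ
        ≤ ∑' i, (‖star (W * U * S) (stdBasis H i)‖ₑ ^ 2 + ‖S (stdBasis H i)‖ₑ ^ 2) := by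
          refine ENNReal.tsum_le_tsum fun i => ?_
          rw [h1, ← ContinuousLinearMap.adjoint_inner_left,
            ← ContinuousLinearMap.star_eq_adjoint]
          exact enorm_inner_le _ _
      _ = hsSq (star (W * U * S)) + hsSq S := ENNReal.tsum_add
      _ ≤ ‖W * U‖ₑ ^ 2 * hsSq S + hsSq S := by
          rw [hsSq_adjoint]; gcongr; exact hsSq_mul_le _ _
      _ < ⊤ := by
          refine ENNReal.add_lt_top.mpr ⟨ENNReal.mul_lt_top ?_ hfin, hfin⟩
          exact ENNReal.pow_lt_top enorm_lt_top
  · intro h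
    obtain ⟨V, hV⟩ := exists_abs_eq T
    refine lt_of_le_of_lt (ENNReal.tsum_le_tsum fun i => ?_) (h V)
    rw [← mul_apply_eq_comp, hV, ← ofReal_norm]
    exact ENNReal.ofReal_le_ofReal (RCLike.re_le_norm _)

variable (H) in
/-- The space `L₁(H)` of trace-class operators. -/
def L1 : Submodule ℂ (H →L[ℂ] H) where
  carrier := {T | IsTraceClass T}
  zero_mem' := by
    rw [Set.mem_ofPred_eq, isTraceClass_iff]
    simp
  add_mem' := by
    intro S T hS hT
    rw [Set.mem_ofPred_eq, isTraceClass_iff] at *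
    intro W
    refine lt_of_le_of_lt (ENNReal.tsum_le_tsum fun i => ?_)
      (ENNReal.tsum_add.trans_lt (ENNReal.add_lt_top.mpr ⟨hS W, hT W⟩))
    rw [add_apply, map_add, inner_add_right]
    exact enorm_add_le _ _
  smul_mem' := by
    intro c T hT
    rw [Set.mem_ofPred_eq, isTraceClass_iff] at *
    intro W
    have := hT (c • W)
    simpa using this

/-- The rank-one operator `|a⟩⟨c|`, that is `v ↦ ⟨c, v⟩ a`, as an element of `L₁(H)`. -/
def ketBra (a c : H) : L1 H :=
  ⟨InnerProductSpace.rankOne ℂ a c, by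
    change IsTraceClass _
    rw [isTraceClass_iff]
    intro W
    refine lt_of_le_of_lt (ENNReal.tsum_le_tsum fun i => ?_)
      (ENNReal.tsum_add.trans_lt (ENNReal.add_lt_top.mpr
        ⟨(tsum_sq_basis (H := H) c).trans_lt (ENNReal.pow_lt_top enorm_lt_top),
          (tsum_sq_basis (H := H) (W a)).trans_lt (ENNReal.pow_lt_top enorm_lt_top)⟩))
    rw [InnerProductSpace.rankOne_apply, map_smul, inner_smul_right, ← ofReal_norm,
      ← ofReal_norm, ← ofReal_norm, norm_mul, norm_inner_symm c,
      ← ENNReal.ofReal_pow (norm_nonneg _), ← ENNReal.ofReal_pow (norm_nonneg _),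
      ← ENNReal.ofReal_add (by positivity) (by positivity)]
    refine ENNReal.ofReal_le_ofReal ?_
    nlinarith [sq_nonneg (‖⟪stdBasis H i, c⟫_ℂ‖ - ‖⟪stdBasis H i, W a⟫_ℂ‖),
      sq_nonneg (‖⟪stdBasis H i, c⟫_ℂ‖ + ‖⟪stdBasis H i, W a⟫_ℂ‖)]⟩

/-- A state (density operator): positive, trace class, with unit trace. -/
structure IsState (ρ : H →L[ℂ] H) : Prop where
  isPositive : ρ.IsPositive
  isTraceClass : IsTraceClass ρ
  trace_eq_one : trace ρ = 1

end TraceClass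

/-! ### Completely positive maps on `L₁(H)`, dual maps, and the `Θ`-KMS adjoint -/

section Maps

variable {H : Type*} [NormedAddCommGroup H] [InnerProductSpace ℂ H] [CompleteSpace H]

/-- The operator on `H ⊕ ⋯ ⊕ H` with block matrix `X` is positive:
`∑ᵢⱼ ⟨vᵢ, Xᵢⱼ vⱼ⟩ ≥ 0` (in particular real) for all `v₁, …, vₙ`. -/
def BlockPositive {n : ℕ} (X : Fin n → Fin n → H →L[ℂ] H) : Prop :=
  ∀ v : Fin n → H, 0 ≤ ∑ i, ∑ j, ⟪v i, X i j (v j)⟫_ℂ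

/-- `Φs` is a bounded (for the trace norm) completely positive linear map on `L₁(H)`: every
amplification `Φs ⊗ idₙ` maps positive block matrices to positive block matrices. -/
structure IsBoundedCP (Φs : L1 H →ₗ[ℂ] L1 H) : Prop where
  bounded : ∃ C : NNReal, ∀ x : L1 H,
    traceNorm (Φs x : H →L[ℂ] H) ≤ C * traceNorm (x : H →L[ℂ] H)
  completelyPositive : ∀ (n : ℕ) (X : Fin n → Fin n → L1 H),
    BlockPositive (fun i j => (X i j : H →L[ℂ] H)) →
      BlockPositive (fun i j => (Φs (X i j) : H →L[ℂ] H))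

/-- `Φ : B(H) → B(H)` is the dual map of `Φs : L₁(H) → L₁(H)` (and `Φs` the predual map of `Φ`):
`tr(Φs(x) y) = tr(x Φ(y))` for all `x ∈ L₁(H)`, `y ∈ B(H)`. -/
def IsDualMap (Φs : L1 H →ₗ[ℂ] L1 H) (Φ : (H →L[ℂ] H) →ₗ[ℂ] (H →L[ℂ] H)) : Prop :=
  ∀ (x : L1 H) (y : H →L[ℂ] H),
    trace ((Φs x : H →L[ℂ] H) * y) = trace ((x : H →L[ℂ] H) * Φ y)

/-- The reversing operation `Θ(x) = θ x* θ` of an anti-unitary operator `θ` (a bijective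
conjugate-linear isometry). -/
def reversing (θ : H ≃ₗᵢ⋆[ℂ] H) (x : H →L[ℂ] H) : H →L[ℂ] H :=
  (θ.toContinuousLinearEquiv : H →L⋆[ℂ] H).comp
    ((star x).comp (θ.toContinuousLinearEquiv : H →L⋆[ℂ] H))

/-- `ΦΘ` is a `Θ`-KMS adjoint of `Φ` with respect to `ρ`:
`tr(ρ^{1/2} Θ(x*) ρ^{1/2} Φ(y)) = tr(ρ^{1/2} Θ(ΦΘ(x*)) ρ^{1/2} y)` for all `x, y ∈ B(H)`. -/
def IsThetaKMSAdjoint (θ : H ≃ₗᵢ⋆[ℂ] H) (ρ : H →L[ℂ] H)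
    (Φ ΦΘ : (H →L[ℂ] H) →ₗ[ℂ] (H →L[ℂ] H)) : Prop :=
  ∀ x y : H →L[ℂ] H,
    trace (CFC.sqrt ρ * reversing θ (star x) * CFC.sqrt ρ * Φ y) =
      trace (CFC.sqrt ρ * reversing θ (ΦΘ (star x)) * CFC.sqrt ρ * y)

end Maps

/-! ### The Hilbert space tensor square, the flip, and the Choi-Jamiołkowski operator -/

section Tensor

/-- The Hilbert space tensor product `H ⊗ H`, the completion of the algebraic one. -/
abbrev HTensor (H : Type*) [NormedAddCommGroup H] [InnerProductSpace ℂ H] : Type _ :=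
  UniformSpace.Completion (H ⊗[ℂ] H)

variable {H : Type*} [NormedAddCommGroup H] [InnerProductSpace ℂ H]

/-- The simple tensor `u ⊗ v` in the Hilbert space tensor product. -/
def tmul (u v : H) : HTensor H := ((u ⊗ₜ[ℂ] v : H ⊗[ℂ] H) : HTensor H)

variable (H) in
/-- The flip `F`, the bounded operator with `F (u ⊗ v) = v ⊗ u`. -/
def flip : HTensor H →L[ℂ] HTensor H :=
  ((TensorProduct.commIsometry ℂ H H).toContinuousLinearEquiv :
    (H ⊗[ℂ] H) →L[ℂ] (H ⊗[ℂ] H)).completion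

theorem flip_tmul (u v : H) : flip H (tmul u v) = tmul v u := by
  simp [flip, tmul]

variable [CompleteSpace H] {ι : Type*}

/-- `J` is the bounded operator on `H ⊗ H` given by the sesquilinear form
`⟨e_k ⊗ e_l, J (e_k' ⊗ e_l')⟩ = ⟨e_l, Φs(|ρ^{1/2} e_k⟩⟨ρ^{1/2} e_k'|) e_l'⟩`. -/
def IsRhoChoi (e : HilbertBasis ι ℂ H) (ρ : H →L[ℂ] H) (Φs : L1 H →ₗ[ℂ] L1 H)
    (J : HTensor H →L[ℂ] HTensor H) : Prop :=
  ∀ k l k' l' : ι,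
    ⟪tmul (e k) (e l), J (tmul (e k') (e l'))⟫_ℂ =
      ⟪e l, (Φs (ketBra (CFC.sqrt ρ (e k)) (CFC.sqrt ρ (e k'))) : H →L[ℂ] H) (e l')⟫_ℂ

open Classical in
/-- The `ρ`-Choi-Jamiołkowski operator `J_ρ(Φs) = (1 ⊗ Φs)(ω_ρ)` with respect to the orthonormal
basis `e`, i.e. the unique bounded operator with `IsRhoChoi e ρ Φs J` (zero if there is none,
which does not happen for a state `ρ` and a bounded completely positive `Φs`). -/
def rhoChoi (e : HilbertBasis ι ℂ H) (ρ : H →L[ℂ] H) (Φs : L1 H →ₗ[ℂ] L1 H) :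
    HTensor H →L[ℂ] HTensor H :=
  if h : ∃ J, IsRhoChoi e ρ Φs J then h.choose else 0

end Tensor

/-! ### The logarithm of a strictly positive trace-class operator -/

section Log

variable {K : Type*} [NormedAddCommGroup K] [InnerProductSpace ℂ K] [CompleteSpace K]

/-- Strictly positive: positive, and `⟨u, x u⟩ > 0` for `u ≠ 0`. -/
def StrictlyPositive (x : K →L[ℂ] K) : Prop :=
  x.IsPositive ∧ ∀ u : K, u ≠ 0 → 0 < RCLike.re ⟪u, x u⟫_ℂ

/-- The orthogonal projection onto the eigenspace `ker (x - μ)`. -/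
def eigenProj (x : K →L[ℂ] K) (μ : ℝ) : K →L[ℂ] K :=
  (x - (μ : ℂ) • ContinuousLinearMap.id ℂ K).ker.starProjection

/-- The (in general unbounded) logarithm of an operator `x` with spectral decomposition
`x = ∑_μ μ P_μ`, where `P_μ` is the projection onto the eigenspace of `μ`: `log x = ∑_μ (log μ) P_μ`
on the domain of those `v` for which `∑_μ (log μ) P_μ v` converges, equivalently (the `P_μ v` being
pairwise orthogonal) `∑_μ |log μ|² ‖P_μ v‖² < ∞`. -/
def opLog (x : K →L[ℂ] K) : K →ₗ.[ℂ] K where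
  domain :=
    { carrier := {v | Summable fun μ : ℝ => (Real.log μ : ℂ) • eigenProj x μ v}
      zero_mem' := by simp [summable_zero]
      add_mem' := by
        intro v w hv hw
        simpa [smul_add] using hv.add hw
      smul_mem' := by
        intro c v hv
        simpa [smul_comm _ c] using hv.const_smul c }
  toFun :=
    { toFun := fun v => ∑' μ : ℝ, (Real.log μ : ℂ) • eigenProj x μ (v : K)
      map_add' := by
        intro v w
        simpa [smul_add] using v.2.tsum_add w.2
      map_smul' := by
        intro c v
        simpa [smul_comm _ c] using v.2.tsum_const_smul c }

/-- The operator product `G A G` of a bounded operator `G` and a possibly unbounded `A`, with its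
natural domain `{v | G v ∈ dom A}`. -/
def sandwich (G : K →L[ℂ] K) (A : K →ₗ.[ℂ] K) : K →ₗ.[ℂ] K where
  domain := A.domain.comap G.toLinearMap
  toFun := G.toLinearMap ∘ₗ A.toFun ∘ₗ
    (G.toLinearMap.restrict (p := A.domain.comap G.toLinearMap) (q := A.domain) fun _ h => h)

end Log

end

end ChoiFlip

/-!
The flip `F` is a self-adjoint involution, so both parts are about conjugation by a unitary.

For the logarithm: trace-class operators form an ideal (`IsTraceClass.mul_mul`), because they are
the products of two Hilbert-Schmidt operators, and they are compact
(`IsTraceClass.isCompactOperator`). The spectral theorem for compact operators therefore makes the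
eigenvectors of `x` total, so that `log x` is densely defined. It is symmetric, and a vector `w` in
the domain of its adjoint satisfies `∑ (log μ)² ‖P_μ w‖² < ∞`, as one sees by testing against finite
truncations of `∑ (log μ) P_μ w`; hence `log x` is self-adjoint (`isSelfAdjoint_opLog`). Conjugation
by `F` conjugates every spectral projection (`eigenProj_conj_involution`), and hence the series
defining the logarithm, together with its domain of convergence (`opLog_conj_involution`).

For the Choi-Jamiołkowski operator: complete positivity makes the matrix
`⟨e_l, Φs(|√ρ e_k⟩⟨√ρ e_k'|) e_l'⟩`, indexed by pairs `(k, l)`, positive, and its diagonal sums to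
at most `C tr ρ`, where `C` bounds `Φs` in trace norm (`summable_choiMatrix_diag`). By the
Cauchy-Schwarz inequality the entries are square-summable, so this is the matrix of a
Hilbert-Schmidt operator, which gives existence (`exists_isRhoChoi`). In the basis fixed by `θ`, the
operation `Θ` is the transposition, and it fixes `√ρ` because `θ` commutes with `√ρ`
(`antiunitary_sqrt_comm`). The KMS duality, evaluated at matrix units, then says exactly that the
Choi matrices of `Φs` and `ΦsΘ` differ by exchanging the tensor factors
(`choiMatrix_thetaKMSAdjoint`), that is, by conjugation with `F`.
-/

namespace ChoiFlip

/-! ### Hilbert-Schmidt and trace-class operators -/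

section TraceClass

variable {H : Type*} [NormedAddCommGroup H] [InnerProductSpace ℂ H] {ι : Type*}

theorem _root_.HilbertBasis.hasSum_sq_norm_inner (e : HilbertBasis ι ℂ H) (v : H) :
    HasSum (fun i => ‖⟪e i, v⟫_ℂ‖ ^ 2) (‖v‖ ^ 2) := by
  convert RCLike.hasSum_re ℂ (e.hasSum_inner_mul_inner v v) using 1
  · funext i
    rw [← inner_conj_symm v, RCLike.conj_mul]
    norm_cast
  · rw [inner_self_eq_norm_sq]

theorem tsum_sq_hilbertBasis (e : HilbertBasis ι ℂ H) (v : H) :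
    ∑' i, ‖⟪e i, v⟫_ℂ‖ₑ ^ 2 = ‖v‖ₑ ^ 2 := by
  have h2 := e.hasSum_sq_norm_inner v
  simp only [← ofReal_norm, ← ENNReal.ofReal_pow (norm_nonneg _)]
  rw [← h2.tsum_eq, ENNReal.ofReal_tsum_of_nonneg (fun _ => by positivity) h2.summable]

variable [CompleteSpace H]

/-- The Hilbert-Schmidt norm may be computed in any Hilbert basis. -/
theorem hsSq_eq_tsum (e : HilbertBasis ι ℂ H) (A : H →L[ℂ] H) :
    hsSq A = ∑' i, ‖A (e i)‖ₑ ^ 2 := by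
  rw [← hsSq_adjoint]
  unfold hsSq
  simp_rw [← tsum_sq_hilbertBasis e ((star A) _), ← tsum_sq_basis (H := H) (A _)]
  rw [ENNReal.tsum_comm]
  refine tsum_congr fun i => tsum_congr fun j => ?_
  rw [ContinuousLinearMap.star_eq_adjoint, ContinuousLinearMap.adjoint_inner_right,
    ← inner_conj_symm, ← ofReal_norm, ← ofReal_norm, RCLike.norm_conj]

theorem traceNorm_of_nonneg (e : HilbertBasis ι ℂ H) {T : H →L[ℂ] H} (hT : 0 ≤ T) :
    traceNorm T = ∑' i, ENNReal.ofReal (RCLike.re ⟪e i, T (e i)⟫_ℂ) := by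
  rw [traceNorm_eq_hsSq, CFC.abs_of_nonneg T hT, hsSq_eq_tsum e]
  refine tsum_congr fun i => ?_
  have hs : star (CFC.sqrt T) = CFC.sqrt T := (IsSelfAdjoint.of_nonneg (CFC.sqrt_nonneg T)).star_eq
  conv_rhs => rw [← CFC.sqrt_mul_sqrt_self T hT]
  rw [mul_apply_eq_comp, ← ContinuousLinearMap.adjoint_inner_left,
    ← ContinuousLinearMap.star_eq_adjoint, hs, inner_self_eq_norm_sq,
    ENNReal.ofReal_pow (norm_nonneg _), ofReal_norm]

theorem traceNorm_ketBra_self (a : H) : traceNorm (ketBra a a : H →L[ℂ] H) = ‖a‖ₑ ^ 2 := by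
  have h : (0 : H →L[ℂ] H) ≤ ketBra a a := by
    rw [ContinuousLinearMap.nonneg_iff_isPositive]
    exact InnerProductSpace.isPositive_rankOne_self a
  rw [traceNorm_of_nonneg (stdBasis H) h, ← tsum_sq_basis]
  refine tsum_congr fun i => ?_
  rw [← ofReal_norm, ← ENNReal.ofReal_pow (norm_nonneg _)]
  congr 1
  change RCLike.re ⟪_, InnerProductSpace.rankOne ℂ a a _⟫_ℂ = _
  rw [InnerProductSpace.rankOne_apply, inner_smul_right, ← inner_conj_symm a, RCLike.conj_mul]
  norm_cast

theorem isTraceClass_mul_of_hsSq_lt_top {A B : H →L[ℂ] H} (hA : hsSq A < ⊤) (hB : hsSq B < ⊤) :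
    IsTraceClass (A * B) := by
  rw [isTraceClass_iff]
  intro W
  calc ∑' i, ‖⟪stdBasis H i, W ((A * B) (stdBasis H i))⟫_ℂ‖ₑ
      ≤ ∑' i, (‖star (W * A) (stdBasis H i)‖ₑ ^ 2 + ‖B (stdBasis H i)‖ₑ ^ 2) := by
        refine ENNReal.tsum_le_tsum fun i => ?_
        rw [mul_apply_eq_comp, ← mul_apply_eq_comp W A, ← ContinuousLinearMap.adjoint_inner_left,
          ← ContinuousLinearMap.star_eq_adjoint]
        exact enorm_inner_le _ _
    _ = hsSq (star (W * A)) + hsSq B := ENNReal.tsum_add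
    _ ≤ ‖W‖ₑ ^ 2 * hsSq A + hsSq B := by
        rw [hsSq_adjoint]; gcongr; exact hsSq_mul_le _ _
    _ < ⊤ := ENNReal.add_lt_top.mpr
        ⟨ENNReal.mul_lt_top (ENNReal.pow_lt_top enorm_lt_top) hA, hB⟩

/-- Trace-class operators factor through Hilbert-Schmidt ones, by the polar decomposition. -/
theorem IsTraceClass.exists_hsSq_mul {T : H →L[ℂ] H} (hT : IsTraceClass T) :
    ∃ A B : H →L[ℂ] H, hsSq A < ⊤ ∧ hsSq B < ⊤ ∧ A * B = T := by
  obtain ⟨U, hU⟩ := exists_polar T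
  have hfin : hsSq (CFC.sqrt (CFC.abs T)) < ⊤ := by rw [← traceNorm_eq_hsSq]; exact hT
  refine ⟨U * CFC.sqrt (CFC.abs T), CFC.sqrt (CFC.abs T),
    (hsSq_mul_le _ _).trans_lt
      (ENNReal.mul_lt_top (ENNReal.pow_lt_top enorm_lt_top) hfin), hfin, ?_⟩
  rw [mul_assoc, CFC.sqrt_mul_sqrt_self _ (CFC.abs_nonneg T), hU]

/-- The trace-class operators form a two-sided ideal. -/
theorem IsTraceClass.mul_mul {T : H →L[ℂ] H} (hT : IsTraceClass T) (C D : H →L[ℂ] H) :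
    IsTraceClass (C * T * D) := by
  obtain ⟨A, B, hA, hB, rfl⟩ := hT.exists_hsSq_mul
  have key : ∀ {R S : H →L[ℂ] H}, hsSq S < ⊤ → hsSq (R * S) < ⊤ := fun hS =>
    (hsSq_mul_le _ _).trans_lt (ENNReal.mul_lt_top (ENNReal.pow_lt_top enorm_lt_top) hS)
  have hBD : hsSq (B * D) < ⊤ := by
    rw [← hsSq_adjoint, star_mul]
    exact key (by rwa [hsSq_adjoint])
  rw [← mul_assoc, mul_assoc (C * A)]
  exact isTraceClass_mul_of_hsSq_lt_top (key hA) hBD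

theorem enorm_sq_apply_le_hsSq (A : H →L[ℂ] H) (v : H) : ‖A v‖ₑ ^ 2 ≤ hsSq A * ‖v‖ₑ ^ 2 := by
  rw [← hsSq_adjoint, ← tsum_sq_basis (A v), hsSq, ← ENNReal.tsum_mul_right]
  refine ENNReal.tsum_le_tsum fun i => ?_
  rw [← mul_pow, ContinuousLinearMap.star_eq_adjoint, ← ContinuousLinearMap.adjoint_inner_left]
  gcongr
  simp only [← ofReal_norm]
  rw [← ENNReal.ofReal_mul (norm_nonneg _)]
  exact ENNReal.ofReal_le_ofReal (norm_inner_le_norm _ _)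

theorem enorm_sq_le_hsSq (A : H →L[ℂ] H) : ‖A‖ₑ ^ 2 ≤ hsSq A := by
  by_cases htop : hsSq A = ⊤
  · simp [htop]
  have h : ‖A‖ ≤ √(hsSq A).toReal := by
    refine A.opNorm_le_bound (Real.sqrt_nonneg _) fun v => ?_
    refine le_of_sq_le_sq ?_ (by positivity)
    rw [mul_pow, Real.sq_sqrt ENNReal.toReal_nonneg]
    have := ENNReal.toReal_mono (by finiteness) (enorm_sq_apply_le_hsSq A v)
    simpa using this
  rw [← ENNReal.ofReal_toReal htop, ← ofReal_norm, ← ENNReal.ofReal_pow (norm_nonneg _)]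
  refine ENNReal.ofReal_le_ofReal ?_
  calc ‖A‖ ^ 2 ≤ √(hsSq A).toReal ^ 2 := by gcongr
    _ = _ := Real.sq_sqrt ENNReal.toReal_nonneg

/-- Hilbert-Schmidt operators are compact: restricting `A` to the spans of finite sets of basis
vectors approximates it by operators of finite rank in Hilbert-Schmidt norm. -/
theorem isCompactOperator_of_hsSq_lt_top {A : H →L[ℂ] H} (hA : hsSq A < ⊤) :
    IsCompactOperator A := by
  classical
  set b := stdBasis H with hb
  let F : Finset (stdIdx H) → H →L[ℂ] H := fun s =>
    ∑ i ∈ s, InnerProductSpace.rankOne ℂ (A (b i)) (b i)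
  have hF : ∀ s, IsCompactOperator (F s) := by
    intro s
    have : F s ∈ compactOperator (RingHom.id ℂ) H H := by
      refine Submodule.sum_mem _ fun i _ => ?_
      change IsCompactOperator _
      exact (isCompactOperator_of_locallyCompactSpace_rng
        (ContinuousLinearMap.toSpanSingleton ℂ (A (b i)))).comp_clm (innerSL ℂ (b i))
    exact this
  have hFb : ∀ s i, (A - F s) (b i) = if i ∈ s then 0 else A (b i) := by
    intro s i
    have : (F s) (b i) = if i ∈ s then A (b i) else 0 := by
      simp only [F, sum_apply, InnerProductSpace.rankOne_apply,
        orthonormal_iff_ite.mp b.orthonormal, ite_smul, one_smul, zero_smul]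
      simp
    rw [sub_apply, this]
    split_ifs <;> simp
  have hhs : ∀ s, hsSq (A - F s) = ∑' i : {i // i ∉ s}, ‖A (b i)‖ₑ ^ 2 := by
    intro s
    rw [hsSq, ← hb]
    rw [show (∑' i : {i // i ∉ s}, ‖A (b i)‖ₑ ^ 2) =
      ∑' i, Set.indicator {i | i ∉ s} (fun i => ‖A (b i)‖ₑ ^ 2) i from
      tsum_subtype {i | i ∉ s} (fun i => ‖A (b i)‖ₑ ^ 2)]
    refine tsum_congr fun i => ?_
    rw [hFb]
    by_cases hi : i ∈ s <;> simp [hi]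
  have hlim : Filter.Tendsto (fun s => hsSq (A - F s)) Filter.atTop (nhds 0) := by
    simp_rw [hhs]
    exact ENNReal.tendsto_tsum_compl_atTop_zero hA.ne
  refine isCompactOperator_of_tendsto (F := F) (l := Filter.atTop) ?_
    (Filter.Eventually.of_forall hF)
  rw [tendsto_iff_edist_tendsto_0]
  have h2 : Filter.Tendsto (fun s => ‖A - F s‖ₑ ^ 2) Filter.atTop (nhds 0) :=
    tendsto_of_tendsto_of_tendsto_of_le_of_le tendsto_const_nhds hlim (fun _ => zero_le)
      fun s => enorm_sq_le_hsSq _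
  have h3 := h2.ennrpow_const (1 / 2)
  rw [ENNReal.zero_rpow_of_pos (by norm_num)] at h3
  refine h3.congr fun s => ?_
  rw [edist_comm, edist_eq_enorm_sub, ← ENNReal.rpow_natCast, ← ENNReal.rpow_mul]
  norm_num

theorem IsTraceClass.isCompactOperator {T : H →L[ℂ] H} (hT : IsTraceClass T) :
    IsCompactOperator T := by
  obtain ⟨A, B, hA, -, rfl⟩ := hT.exists_hsSq_mul
  exact (isCompactOperator_of_hsSq_lt_top hA).comp_clm B

theorem trace_mul_ketBra (T : H →L[ℂ] H) (a b : H) :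
    trace (T * (ketBra a b : H →L[ℂ] H)) = ⟪b, T a⟫_ℂ := by
  rw [trace, ← (stdBasis H).tsum_inner_mul_inner b (T a)]
  refine tsum_congr fun i => ?_
  change ⟪_, T (InnerProductSpace.rankOne ℂ a b _)⟫_ℂ = _
  rw [InnerProductSpace.rankOne_apply, map_smul, inner_smul_right]

theorem trace_ketBra_mul (T : H →L[ℂ] H) (a b : H) :
    trace ((ketBra a b : H →L[ℂ] H) * T) = ⟪b, T a⟫_ℂ := by
  rw [trace, ← ContinuousLinearMap.adjoint_inner_left,
    ← (stdBasis H).tsum_inner_mul_inner _ a]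
  refine tsum_congr fun i => ?_
  change ⟪_, InnerProductSpace.rankOne ℂ a b (T _)⟫_ℂ = _
  rw [InnerProductSpace.rankOne_apply, inner_smul_right, ContinuousLinearMap.adjoint_inner_left]

end TraceClass

/-! ### The logarithm -/

section Log

variable {K : Type*} [NormedAddCommGroup K] [InnerProductSpace ℂ K]

/-- The eigenspace of `x` for a real number `μ`, as the kernel of the bounded operator `x - μ`;
`eigenProj x μ` is the orthogonal projection onto it. -/
noncomputable abbrev realEigenspace (x : K →L[ℂ] K) (μ : ℝ) : Submodule ℂ K :=
  (x - (μ : ℂ) • ContinuousLinearMap.id ℂ K).ker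

theorem mem_realEigenspace {x : K →L[ℂ] K} {μ : ℝ} {v : K} :
    v ∈ realEigenspace x μ ↔ x v = (μ : ℂ) • v := by
  simp [realEigenspace, LinearMap.mem_ker, sub_eq_zero]

theorem realEigenspace_eq (x : K →L[ℂ] K) (μ : ℝ) :
    realEigenspace x μ = Module.End.eigenspace (x : K →ₗ[ℂ] K) μ := by
  ext v
  rw [mem_realEigenspace, Module.End.mem_eigenspace_iff]
  rfl

theorem orthogonalFamily_realEigenspace {x : K →L[ℂ] K} (hx : (x : K →ₗ[ℂ] K).IsSymmetric) :
    OrthogonalFamily ℂ (fun μ : ℝ => realEigenspace x μ)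
      fun μ => (realEigenspace x μ).subtypeₗᵢ := by
  intro μ ν h v w
  refine hx.orthogonalFamily_eigenspaces (i := (μ : ℂ)) (j := (ν : ℂ))
    (by exact_mod_cast h) ⟨v, ?_⟩ ⟨w, ?_⟩
  · rw [← realEigenspace_eq]; exact v.2
  · rw [← realEigenspace_eq]; exact w.2

variable [CompleteSpace K]

theorem eigenProj_mem (x : K →L[ℂ] K) (μ : ℝ) (v : K) : eigenProj x μ v ∈ realEigenspace x μ :=
  Submodule.starProjection_apply_mem _ _

theorem eigenProj_of_mem {x : K →L[ℂ] K} {μ : ℝ} {v : K} (hv : v ∈ realEigenspace x μ) :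
    eigenProj x μ v = v :=
  Submodule.starProjection_eq_self_iff.mpr hv

theorem eigenProj_of_mem_of_ne {x : K →L[ℂ] K} (hx : (x : K →ₗ[ℂ] K).IsSymmetric) {μ ν : ℝ}
    (h : μ ≠ ν) {v : K} (hv : v ∈ realEigenspace x ν) : eigenProj x μ v = 0 := by
  rw [eigenProj, Submodule.starProjection_apply_eq_zero_iff]
  intro w hw
  exact orthogonalFamily_realEigenspace hx h ⟨w, hw⟩ ⟨v, hv⟩

theorem inner_eigenProj_left (x : K →L[ℂ] K) (μ : ℝ) (v w : K) :
    ⟪eigenProj x μ v, w⟫_ℂ = ⟪v, eigenProj x μ w⟫_ℂ :=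
  Submodule.inner_starProjection_left_eq_right _ v w

theorem inner_self_eigenProj (x : K →L[ℂ] K) (μ : ℝ) (v : K) :
    ⟪v, eigenProj x μ v⟫_ℂ = (‖eigenProj x μ v‖ ^ 2 : ℝ) := by
  conv_lhs => rw [← eigenProj_of_mem (eigenProj_mem x μ v)]
  rw [← inner_eigenProj_left, inner_self_eq_norm_sq_to_K]
  norm_cast

theorem mem_domain_opLog {x : K →L[ℂ] K} {v : K} :
    v ∈ (opLog x).domain ↔ Summable fun μ : ℝ => (Real.log μ : ℂ) • eigenProj x μ v :=
  Iff.rfl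

theorem opLog_apply (x : K →L[ℂ] K) (v : (opLog x).domain) :
    opLog x v = ∑' μ : ℝ, (Real.log μ : ℂ) • eigenProj x μ (v : K) :=
  rfl

/-- Eigenvectors lie in the domain of the logarithm, which multiplies them by the logarithm of the
eigenvalue. -/
theorem hasSum_log_smul_of_mem {x : K →L[ℂ] K} (hx : (x : K →ₗ[ℂ] K).IsSymmetric) {ν : ℝ} {v : K}
    (hv : v ∈ realEigenspace x ν) :
    HasSum (fun μ : ℝ => (Real.log μ : ℂ) • eigenProj x μ v) ((Real.log ν : ℂ) • v) := by
  have := hasSum_single (f := fun μ : ℝ => (Real.log μ : ℂ) • eigenProj x μ v) ν fun μ h => by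
    simp [eigenProj_of_mem_of_ne hx h hv]
  rwa [eigenProj_of_mem hv] at this

/-- By the spectral theorem for compact operators, `log x` is densely defined. -/
theorem dense_domain_opLog {x : K →L[ℂ] K} (hc : IsCompactOperator x)
    (hx : (x : K →ₗ[ℂ] K).IsSymmetric) : Dense ((opLog x).domain : Set K) := by
  have hle : (⨆ μ, Module.End.eigenspace (x : K →ₗ[ℂ] K) μ) ≤ (opLog x).domain := by
    refine iSup_le fun μ v hv => ?_
    by_cases hv0 : v = 0
    · rw [hv0]; exact zero_mem _
    have hμ : (μ.re : ℂ) = μ := Complex.conj_eq_iff_re.mp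
      (hx.conj_eigenvalue_eq_self (Module.End.hasEigenvalue_of_hasEigenvector ⟨hv, hv0⟩))
    rw [← hμ, ← realEigenspace_eq] at hv
    exact (hasSum_log_smul_of_mem hx hv).summable
  rw [Submodule.dense_iff_topologicalClosure_eq_top, Submodule.topologicalClosure_eq_top_iff,
    eq_bot_iff, ← ContinuousLinearMap.orthogonalComplement_iSup_eigenspaces_eq_bot hc hx]
  exact Submodule.orthogonal_le hle

theorem opLog_isFormalAdjoint (x : K →L[ℂ] K) : (opLog x).IsFormalAdjoint (opLog x) := by
  intro v w
  rw [opLog_apply, opLog_apply]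
  have h1 := (mem_domain_opLog.mp w.2).hasSum.mapL (innerSL ℂ (v : K))
  have h2 := (mem_domain_opLog.mp v.2).hasSum.mapL (innerSL ℂ (w : K))
  have h3 := h2.star
  simp only [innerSL_apply_apply, RCLike.star_def, inner_conj_symm] at h1 h3
  refine h3.unique ?_
  convert h1 using 2 with μ
  rw [inner_smul_left, inner_smul_right, inner_eigenProj_left, Complex.conj_ofReal]

/-- If `w` lies in the domain of the adjoint of `log x`, then testing against the truncations
`∑ μ ∈ s, (log μ) P_μ w` bounds the partial sums of `∑ (log μ)² ‖P_μ w‖²`. -/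
theorem domain_adjoint_opLog_le {x : K →L[ℂ] K} (hx : (x : K →ₗ[ℂ] K).IsSymmetric)
    (hd : Dense ((opLog x).domain : Set K)) :
    (opLog x).adjoint.domain ≤ (opLog x).domain := by
  intro w hw
  rw [mem_domain_opLog]
  let f : ∀ μ : ℝ, realEigenspace x μ := fun μ =>
    (Real.log μ : ℂ) • ⟨eigenProj x μ w, eigenProj_mem x μ w⟩
  have hO := orthogonalFamily_realEigenspace hx
  refine (hO.summable_iff_norm_sq_summable f).mpr ?_
  set z := (opLog x).adjoint ⟨w, hw⟩
  refine summable_of_sum_le (c := ‖z‖ ^ 2) (fun _ => by positivity) fun s => ?_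
  -- the test vector, and its image under the logarithm
  set v : K := ∑ μ ∈ s, (f μ : K) with hv
  have hsum : HasSum (fun μ : ℝ => (Real.log μ : ℂ) • eigenProj x μ v)
      (∑ μ ∈ s, (Real.log μ : ℂ) • (f μ : K)) := by
    have := hasSum_sum fun μ (_ : μ ∈ s) => hasSum_log_smul_of_mem hx (f μ).2
    simpa [hv, Finset.smul_sum] using this
  have hvd : v ∈ (opLog x).domain := hsum.summable
  have hadj : ⟪z, v⟫_ℂ = ⟪w, ∑ μ ∈ s, (Real.log μ : ℂ) • (f μ : K)⟫_ℂ := by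
    rw [← hsum.tsum_eq]
    exact LinearPMap.adjoint_isFormalAdjoint hd ⟨w, hw⟩ ⟨v, hvd⟩
  have hn : ‖v‖ ^ 2 = ∑ μ ∈ s, ‖f μ‖ ^ 2 := hO.norm_sum f s
  have hr : ⟪w, ∑ μ ∈ s, (Real.log μ : ℂ) • (f μ : K)⟫_ℂ = (‖v‖ ^ 2 : ℝ) := by
    rw [hn, inner_sum, Complex.ofReal_sum]
    refine Finset.sum_congr rfl fun μ _ => ?_
    simp only [f, Submodule.coe_smul, inner_smul_right, inner_self_eigenProj, norm_smul, mul_pow,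
      Submodule.coe_norm, Complex.norm_real, Real.norm_eq_abs, sq_abs]
    push_cast
    ring
  have hle : ‖v‖ ^ 2 ≤ ‖z‖ * ‖v‖ := by
    have := norm_inner_le_norm (𝕜 := ℂ) z v
    rwa [hadj, hr, Complex.norm_real, Real.norm_of_nonneg (by positivity)] at this
  rw [← hn]
  have hvz : ‖v‖ ≤ ‖z‖ := by
    by_contra! h
    nlinarith [norm_nonneg z]
  gcongr

theorem isSelfAdjoint_opLog {x : K →L[ℂ] K} (hc : IsCompactOperator x)
    (hx : (x : K →ₗ[ℂ] K).IsSymmetric) : IsSelfAdjoint (opLog x) := by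
  have hd := dense_domain_opLog hc hx
  rw [LinearPMap.isSelfAdjoint_def]
  have hle := LinearPMap.IsFormalAdjoint.le_adjoint hd (opLog_isFormalAdjoint x)
  exact (LinearPMap.eq_of_le_of_domain_eq hle
    (le_antisymm hle.1 (domain_adjoint_opLog_le hx hd))).symm

section Sandwich

variable {G : K →L[ℂ] K}

theorem StrictlyPositive.conj_involution (hG : G * G = 1) (hs : IsSelfAdjoint G) {x : K →L[ℂ] K}
    (hx : StrictlyPositive x) : StrictlyPositive (G * x * G) := by
  have hinner : ∀ u v : K, ⟪u, G v⟫_ℂ = ⟪G u, v⟫_ℂ := fun u v => by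
    rw [← ContinuousLinearMap.adjoint_inner_left, ← ContinuousLinearMap.star_eq_adjoint,
      hs.star_eq]
  refine ⟨?_, fun u hu => ?_⟩
  · have := hx.1.conj_adjoint G
    rwa [← ContinuousLinearMap.star_eq_adjoint, hs.star_eq] at this
  · rw [mul_apply_eq_comp, mul_apply_eq_comp, hinner]
    refine hx.2 _ fun h => hu ?_
    rw [← one_apply_eq_self (F := K →L[ℂ] K) u, ← hG, mul_apply_eq_comp, h, map_zero]

/-- Conjugation by a self-adjoint involution conjugates the spectral projections: it maps each
eigenspace onto the corresponding one and preserves orthogonal complements. -/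
theorem eigenProj_conj_involution (hG : G * G = 1) (hs : IsSelfAdjoint G) (x : K →L[ℂ] K) (μ : ℝ)
    (v : K) : eigenProj (G * x * G) μ v = G (eigenProj x μ (G v)) := by
  have hGG : ∀ u, G (G u) = u := fun u => by rw [← mul_apply_eq_comp, hG, one_apply_eq_self]
  have hinner : ∀ u v : K, ⟪u, G v⟫_ℂ = ⟪G u, v⟫_ℂ := fun u v => by
    rw [← ContinuousLinearMap.adjoint_inner_left, ← ContinuousLinearMap.star_eq_adjoint,
      hs.star_eq]
  refine Submodule.eq_starProjection_of_mem_orthogonal ?_ ?_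
  · change _ ∈ realEigenspace _ _
    rw [mem_realEigenspace, mul_apply_eq_comp, mul_apply_eq_comp, hGG,
      mem_realEigenspace.mp (eigenProj_mem x μ (G v)), map_smul]
  · intro w hw
    change w ∈ realEigenspace _ _ at hw
    rw [mem_realEigenspace, mul_apply_eq_comp, mul_apply_eq_comp] at hw
    have hw' : G w ∈ realEigenspace x μ := by
      rw [mem_realEigenspace, ← map_smul, ← hw, hGG]
    rw [← hGG (v - _), map_sub, hGG, hinner]
    exact Submodule.sub_starProjection_mem_orthogonal (K := realEigenspace x μ) (G v) _ hw'

theorem opLog_conj_involution (hG : G * G = 1) (hs : IsSelfAdjoint G) (x : K →L[ℂ] K) :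
    opLog (G * x * G) = sandwich G (opLog x) := by
  have hGG : ∀ u, G (G u) = u := fun u => by rw [← mul_apply_eq_comp, hG, one_apply_eq_self]
  have hterm : ∀ (v : K) (μ : ℝ), (Real.log μ : ℂ) • eigenProj (G * x * G) μ v =
      G ((Real.log μ : ℂ) • eigenProj x μ (G v)) := fun v μ => by
    rw [eigenProj_conj_involution hG hs, map_smul]
  have hdom : ∀ v : K, v ∈ (opLog (G * x * G)).domain ↔ G v ∈ (opLog x).domain := by
    intro v
    rw [mem_domain_opLog, mem_domain_opLog]
    simp_rw [hterm]
    refine ⟨fun h => ?_, fun h => h.mapL G⟩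
    simpa [hGG] using h.mapL G
  refine LinearPMap.ext (Submodule.ext hdom) ?_
  rintro v hv hv'
  have hs' : Summable fun μ : ℝ => (Real.log μ : ℂ) • eigenProj x μ (G v) := hv'
  change ∑' μ : ℝ, (Real.log μ : ℂ) • eigenProj (G * x * G) μ v =
    G (∑' μ : ℝ, (Real.log μ : ℂ) • eigenProj x μ (G v))
  simp_rw [hterm]
  exact (hs'.hasSum.mapL G).tsum_eq

end Sandwich

end Log

/-! ### The flip and the product basis of the tensor square -/

section Tensor

variable {H : Type*} [NormedAddCommGroup H] [InnerProductSpace ℂ H] {ι : Type*}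

theorem inner_tmul_tmul (u v u' v' : H) :
    ⟪tmul u v, tmul u' v'⟫_ℂ = ⟪u, u'⟫_ℂ * ⟪v, v'⟫_ℂ := by
  rw [tmul, tmul, UniformSpace.Completion.inner_coe, TensorProduct.inner_tmul]

theorem continuous_tmul_left (v : H) : Continuous fun u : H => tmul u v :=
  (UniformSpace.Completion.continuous_coe _).comp
    (TensorProduct.continuous_tmul.comp (Continuous.prodMk_left v))

theorem continuous_tmul_right (u : H) : Continuous fun v : H => tmul u v :=
  (UniformSpace.Completion.continuous_coe _).comp
    (TensorProduct.continuous_tmul.comp (Continuous.prodMk_right u))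

/-- A subspace containing all simple tensors is dense. -/
theorem dense_of_tmul_mem {S : Submodule ℂ (HTensor H)} (hS : ∀ u v, tmul u v ∈ S) :
    Dense (S : Set (HTensor H)) := by
  refine UniformSpace.Completion.denseRange_coe.mono ?_
  rintro _ ⟨t, rfl⟩
  induction t with
  | zero => rw [UniformSpace.Completion.coe_zero]; exact S.zero_mem
  | tmul u v => exact hS u v
  | add a b ha hb => rw [UniformSpace.Completion.coe_add]; exact S.add_mem ha hb

/-- The Hilbert basis `e_k ⊗ e_l` of the Hilbert space tensor square. -/
noncomputable def tmulBasis (e : HilbertBasis ι ℂ H) : HilbertBasis (ι × ι) ℂ (HTensor H) :=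
  HilbertBasis.mk (v := fun p : ι × ι => tmul (e p.1) (e p.2))
    (by
      classical
      rw [orthonormal_iff_ite]
      rintro ⟨k, l⟩ ⟨k', l'⟩
      rw [inner_tmul_tmul, orthonormal_iff_ite.mp e.orthonormal,
        orthonormal_iff_ite.mp e.orthonormal]
      by_cases h : k = k' <;> by_cases h' : l = l' <;> simp [h, h'])
    (by
      set S : Submodule ℂ (HTensor H) :=
        (Submodule.span ℂ (Set.range fun p : ι × ι => tmul (e p.1) (e p.2))).topologicalClosure
      have hc : IsClosed (S : Set (HTensor H)) := Submodule.isClosed_topologicalClosure _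
      -- a closed subspace containing `u ⊗ e_l` for basis vectors `u` contains it for all `u`
      have key : ∀ T : Submodule ℂ H, IsClosed (T : Set H) → (∀ i, e i ∈ T) → ∀ u, u ∈ T := by
        intro T hT he u
        have h1 : (Submodule.span ℂ (Set.range e)).topologicalClosure ≤ T :=
          Submodule.topologicalClosure_minimal _
            (Submodule.span_le.mpr (Set.range_subset_iff.mpr he)) hT
        rw [e.dense_span] at h1
        exact h1 trivial
      let L : H → H →ₗ[ℂ] HTensor H := fun v =>
        (UniformSpace.Completion.toComplL (𝕜 := ℂ) (E := H ⊗[ℂ] H)).toLinearMap ∘ₗ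
          (TensorProduct.mk ℂ H H).flip v
      let R : H → H →ₗ[ℂ] HTensor H := fun u =>
        (UniformSpace.Completion.toComplL (𝕜 := ℂ) (E := H ⊗[ℂ] H)).toLinearMap ∘ₗ
          TensorProduct.mk ℂ H H u
      have h1 : ∀ u l, tmul u (e l) ∈ S := fun u l =>
        key (S.comap (L (e l))) (hc.preimage (continuous_tmul_left (e l)))
          (fun k => Submodule.le_topologicalClosure _ (Submodule.subset_span ⟨(k, l), rfl⟩)) u
      have h2 : ∀ u v, tmul u v ∈ S := fun u v =>
        key (S.comap (R u)) (hc.preimage (continuous_tmul_right u)) (fun l => h1 u l) v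
      have h3 := dense_of_tmul_mem h2
      intro x _
      have h4 := h3 x
      rwa [hc.closure_eq] at h4)

theorem tmulBasis_apply (e : HilbertBasis ι ℂ H) (p : ι × ι) :
    tmulBasis e p = tmul (e p.1) (e p.2) := by
  rw [tmulBasis, HilbertBasis.coe_mk]

/-- A bounded operator is determined by its matrix in a Hilbert basis. -/
theorem _root_.HilbertBasis.clm_ext {K : Type*} [NormedAddCommGroup K] [InnerProductSpace ℂ K]
    {α : Type*} (E : HilbertBasis α ℂ K) {A B : K →L[ℂ] K}
    (h : ∀ a b, ⟪E a, A (E b)⟫_ℂ = ⟪E a, B (E b)⟫_ℂ) : A = B := by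
  refine ContinuousLinearMap.ext_on
    (Submodule.dense_iff_topologicalClosure_eq_top.mpr E.dense_span) ?_
  rintro _ ⟨b, rfl⟩
  refine E.repr.injective (lp.ext (funext fun a => ?_))
  rw [E.repr_apply_apply, E.repr_apply_apply, h]

/-- To check an identity of bounded operators on the tensor square, simple tensors suffice. -/
theorem clm_ext_tmul {A B : HTensor H →L[ℂ] HTensor H} (h : ∀ u v, A (tmul u v) = B (tmul u v)) :
    A = B := by
  refine ContinuousLinearMap.ext_on
    (dense_of_tmul_mem (S := Submodule.span ℂ (Set.range fun p : H × H => tmul p.1 p.2))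
      fun u v => Submodule.subset_span ⟨(u, v), rfl⟩) ?_
  rintro _ ⟨p, rfl⟩
  exact h _ _

theorem flip_mul_flip : flip H * flip H = 1 :=
  clm_ext_tmul fun u v => by simp [mul_apply_eq_comp, flip_tmul]

theorem inner_flip_left (x y : HTensor H) : ⟪flip H x, y⟫_ℂ = ⟪x, flip H y⟫_ℂ := by
  induction x, y using UniformSpace.Completion.induction_on₂ with
  | hp => exact isClosed_eq (by fun_prop) (by fun_prop)
  | ih a b =>
    have hf : ∀ t : H ⊗[ℂ] H, flip H (t : HTensor H) = (TensorProduct.comm ℂ H H t : H ⊗[ℂ] H) :=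
      fun t => by simp [flip]
    rw [hf, hf, UniformSpace.Completion.inner_coe, UniformSpace.Completion.inner_coe,
      ← TensorProduct.inner_comm_comm]
    congr 1
    exact (TensorProduct.comm ℂ H H).symm_apply_apply a

theorem isSelfAdjoint_flip : IsSelfAdjoint (flip H) := by
  rw [ContinuousLinearMap.isSelfAdjoint_iff_isSymmetric]
  exact inner_flip_left

end Tensor

/-! ### Bounded operators from square-summable matrices -/

section Matrix

variable {K : Type*} [NormedAddCommGroup K] [InnerProductSpace ℂ K] [CompleteSpace K] {α : Type*}

/-- A Hilbert basis may be mapped to any square-summable family by a bounded operator. -/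
theorem _root_.HilbertBasis.exists_clm_apply (E : HilbertBasis α ℂ K) (w : α → K)
    (hw : Summable fun a => ‖w a‖ ^ 2) : ∃ J : K →L[ℂ] K, ∀ a, J (E a) = w a := by
  classical
  have hS : ∀ v, Summable fun a => ‖⟪E a, v⟫_ℂ • w a‖ := fun v => by
    refine Summable.of_nonneg_of_le (fun _ => norm_nonneg _) (fun a => ?_)
      ((E.hasSum_sq_norm_inner v).summable.add hw)
    rw [norm_smul]
    nlinarith [sq_nonneg (‖⟪E a, v⟫_ℂ‖ - ‖w a‖), sq_nonneg (‖⟪E a, v⟫_ℂ‖ + ‖w a‖)]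
  let J₀ : K →ₗ[ℂ] K :=
    { toFun := fun v => ∑' a, ⟪E a, v⟫_ℂ • w a
      map_add' := fun u v => by
        simp only [inner_add_right, add_smul]
        exact (hS u).of_norm.tsum_add (hS v).of_norm
      map_smul' := fun c v => by
        simp only [inner_smul_right, mul_smul, RingHom.id_apply]
        exact (hS v).of_norm.tsum_const_smul c }
  refine ⟨J₀.mkContinuous √(∑' a, ‖w a‖ ^ 2) fun v => ?_, fun a => ?_⟩
  · -- the Cauchy-Schwarz inequality
    refine (norm_tsum_le_tsum_norm (hS v)).trans ?_
    refine (hS v).tsum_le_of_sum_le fun s => ?_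
    calc ∑ a ∈ s, ‖⟪E a, v⟫_ℂ • w a‖ = ∑ a ∈ s, ‖w a‖ * ‖⟪E a, v⟫_ℂ‖ :=
          Finset.sum_congr rfl fun a _ => by rw [norm_smul, mul_comm]
      _ ≤ √(∑ a ∈ s, ‖w a‖ ^ 2) * √(∑ a ∈ s, ‖⟪E a, v⟫_ℂ‖ ^ 2) :=
          Real.sum_mul_le_sqrt_mul_sqrt _ _ _
      _ ≤ √(∑' a, ‖w a‖ ^ 2) * √(‖v‖ ^ 2) := by
          gcongr
          · exact hw.sum_le_tsum _ fun _ _ => by positivity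
          · exact sum_le_hasSum _ (fun _ _ => by positivity) (E.hasSum_sq_norm_inner v)
      _ = _ := by rw [Real.sqrt_sq (norm_nonneg _)]
  · change ∑' b, ⟪E b, E a⟫_ℂ • w b = w a
    rw [tsum_eq_single a fun b hb => by
      rw [orthonormal_iff_ite.mp E.orthonormal, if_neg hb, zero_smul]]
    rw [orthonormal_iff_ite.mp E.orthonormal, if_pos rfl, one_smul]

/-- A matrix with square-summable entries is the matrix of a bounded (Hilbert-Schmidt) operator. -/
theorem _root_.HilbertBasis.exists_clm_of_matrix (E : HilbertBasis α ℂ K) (B : α → α → ℂ)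
    (hB : Summable fun p : α × α => ‖B p.1 p.2‖ ^ 2) :
    ∃ J : K →L[ℂ] K, ∀ a b, ⟪E a, J (E b)⟫_ℂ = B a b := by
  have hcol : ∀ b, Summable fun a => ‖B a b‖ ^ 2 := fun b =>
    hB.comp_injective (i := fun a => (a, b)) fun _ _ h => (Prod.ext_iff.mp h).1
  have hmem : ∀ b, Memℓp (fun a => B a b) 2 := fun b =>
    memℓp_gen (by simpa using hcol b)
  let w : α → K := fun b => E.repr.symm ⟨fun a => B a b, hmem b⟩
  have hw : ∀ b, ‖w b‖ ^ 2 = ∑' a, ‖B a b‖ ^ 2 := fun b => by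
    rw [LinearIsometryEquiv.norm_map]
    have := lp.norm_rpow_eq_tsum (p := 2) (by norm_num)
      (⟨fun a => B a b, hmem b⟩ : lp (fun _ : α => ℂ) 2)
    simpa using this
  obtain ⟨J, hJ⟩ := E.exists_clm_apply w (by
    simp_rw [hw]
    exact hB.prod_symm.prod)
  refine ⟨J, fun a b => ?_⟩
  rw [hJ, ← E.repr_apply_apply, LinearIsometryEquiv.apply_symm_apply]

end Matrix

/-! ### Existence of the Choi-Jamiołkowski operator -/

/-- The Cauchy-Schwarz inequality for the entries of a positive `2 × 2` matrix. -/
theorem norm_sq_le_of_forall_nonneg {p q r s : ℂ}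
    (h : ∀ c d : ℂ, 0 ≤ star c * p * c + star c * q * d + star d * r * c + star d * s * d) :
    ‖q‖ ^ 2 ≤ p.re * s.re := by
  have hp := h 1 0
  have hs := h 0 1
  have h1 := h 1 1
  have h2 := h 1 Complex.I
  simp only [Complex.nonneg_iff, RCLike.star_def, map_one, map_zero, Complex.conj_I] at hp hs h1 h2
  simp at hp hs h1 h2
  obtain ⟨hp0, hpi⟩ := hp
  obtain ⟨hs0, hsi⟩ := hs
  have hri : r.im = -q.im := by linarith [h1.2]
  have hrr : r.re = q.re := by linarith [h2.2]
  have hq : ‖q‖ ^ 2 = q.re ^ 2 + q.im ^ 2 := by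
    rw [Complex.sq_norm, Complex.normSq_apply]; ring
  -- the vectors `(-t q, 1)` make the form a nonnegative real quadratic polynomial in `t`
  have key : ∀ t : ℝ, 0 ≤ (p.re * ‖q‖ ^ 2) * (t * t) + (-2 * ‖q‖ ^ 2) * t + s.re := by
    intro t
    have h3 := (Complex.nonneg_iff.mp (h (-(t * q)) 1)).1
    simp [hrr, hri, ← hpi] at h3
    rw [hq]
    nlinarith [h3]
  have hd := discrim_le_zero key
  rw [discrim] at hd
  by_cases hq0 : ‖q‖ ^ 2 = 0
  · rw [hq0]; positivity
  · have : 0 < ‖q‖ ^ 2 := lt_of_le_of_ne (by positivity) (Ne.symm hq0)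
    nlinarith

section Choi

variable {H : Type*} [NormedAddCommGroup H] [InnerProductSpace ℂ H] [CompleteSpace H] {ι : Type*}

theorem ketBra_apply (a c v : H) : (ketBra a c : H →L[ℂ] H) v = ⟪c, v⟫_ℂ • a :=
  InnerProductSpace.rankOne_apply ..

/-- The block matrix of the operators `|a_i⟩⟨a_j|` is positive. -/
theorem blockPositive_ketBra {n : ℕ} (a : Fin n → H) :
    BlockPositive fun i j => (ketBra (a i) (a j) : H →L[ℂ] H) := by
  intro v
  have : ∑ i, ∑ j, ⟪v i, (ketBra (a i) (a j) : H →L[ℂ] H) (v j)⟫_ℂ =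
      star (∑ i, ⟪a i, v i⟫_ℂ) * ∑ i, ⟪a i, v i⟫_ℂ := by
    rw [star_sum, Finset.sum_mul_sum]
    refine Finset.sum_congr rfl fun i _ => Finset.sum_congr rfl fun j _ => ?_
    rw [ketBra_apply, inner_smul_right, RCLike.star_def, inner_conj_symm, mul_comm]
  rw [this]
  exact star_mul_self_nonneg _

theorem IsBoundedCP.nonneg_apply_ketBra {Φs : L1 H →ₗ[ℂ] L1 H} (hΦ : IsBoundedCP Φs) (a : H) :
    (0 : H →L[ℂ] H) ≤ Φs (ketBra a a) := by
  rw [ContinuousLinearMap.nonneg_iff_isPositive, ContinuousLinearMap.isPositive_iff_complex]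
  intro v
  have h := hΦ.completelyPositive 1 _ (blockPositive_ketBra fun _ => a) fun _ => v
  simp only [Finset.univ_unique, Finset.sum_singleton] at h
  rw [← inner_conj_symm]
  obtain ⟨h1, h2⟩ := Complex.nonneg_iff.mp h
  rw [Complex.conj_eq_iff_im.mpr h2.symm]
  exact ⟨Complex.ext rfl h2, h1⟩

/-- The matrix of the `ρ`-Choi-Jamiołkowski operator in the product basis. -/
noncomputable def choiMatrix (e : HilbertBasis ι ℂ H) (ρ : H →L[ℂ] H) (Φs : L1 H →ₗ[ℂ] L1 H)
    (p q : ι × ι) : ℂ :=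
  ⟪e p.2, (Φs (ketBra (CFC.sqrt ρ (e p.1)) (CFC.sqrt ρ (e q.1))) : H →L[ℂ] H) (e q.2)⟫_ℂ

theorem isRhoChoi_iff {e : HilbertBasis ι ℂ H} {ρ : H →L[ℂ] H} {Φs : L1 H →ₗ[ℂ] L1 H}
    {J : HTensor H →L[ℂ] HTensor H} :
    IsRhoChoi e ρ Φs J ↔
      ∀ p q, ⟪tmulBasis e p, J (tmulBasis e q)⟫_ℂ = choiMatrix e ρ Φs p q := by
  simp only [tmulBasis_apply, choiMatrix]
  exact ⟨fun h p q => h _ _ _ _, fun h k l k' l' => h (k, l) (k', l')⟩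

theorem choiMatrix_self_re_nonneg (e : HilbertBasis ι ℂ H) (ρ : H →L[ℂ] H) {Φs : L1 H →ₗ[ℂ] L1 H}
    (hΦ : IsBoundedCP Φs) (p : ι × ι) : 0 ≤ (choiMatrix e ρ Φs p p).re :=
  ((ContinuousLinearMap.nonneg_iff_isPositive _).mp
    (hΦ.nonneg_apply_ketBra (CFC.sqrt ρ (e p.1)))).re_inner_nonneg_right _

theorem norm_sq_choiMatrix_le (e : HilbertBasis ι ℂ H) (ρ : H →L[ℂ] H) {Φs : L1 H →ₗ[ℂ] L1 H}
    (hΦ : IsBoundedCP Φs) (p q : ι × ι) :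
    ‖choiMatrix e ρ Φs p q‖ ^ 2 ≤ (choiMatrix e ρ Φs p p).re * (choiMatrix e ρ Φs q q).re := by
  refine norm_sq_le_of_forall_nonneg (r := choiMatrix e ρ Φs q p) fun c d => ?_
  have h := hΦ.completelyPositive 2 _
    (blockPositive_ketBra ![CFC.sqrt ρ (e p.1), CFC.sqrt ρ (e q.1)]) ![c • e p.2, d • e q.2]
  simp only [Fin.sum_univ_two, Matrix.cons_val_zero, Matrix.cons_val_one, map_smul,
    inner_smul_left, inner_smul_right] at h
  convert h using 1
  simp only [choiMatrix, RCLike.star_def]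
  ring

/-- The diagonal of the Choi matrix sums to the trace norms of `Φs |√ρ e_k⟩⟨√ρ e_k|`, which are at
most `C ‖√ρ e_k‖²`, whose sum is `C tr ρ`. -/
theorem summable_choiMatrix_diag (e : HilbertBasis ι ℂ H) {ρ : H →L[ℂ] H} (hρ : IsState ρ)
    {Φs : L1 H →ₗ[ℂ] L1 H} (hΦ : IsBoundedCP Φs) :
    Summable fun p => (choiMatrix e ρ Φs p p).re := by
  obtain ⟨C, hC⟩ := hΦ.bounded
  have hρ0 : 0 ≤ ρ := (ContinuousLinearMap.nonneg_iff_isPositive ρ).mpr hρ.isPositive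
  have hfin : ∑' p, ENNReal.ofReal (choiMatrix e ρ Φs p p).re < ⊤ := by
    rw [ENNReal.tsum_prod']
    calc ∑' k, ∑' l, ENNReal.ofReal (choiMatrix e ρ Φs (k, l) (k, l)).re
        = ∑' k, traceNorm (Φs (ketBra (CFC.sqrt ρ (e k)) (CFC.sqrt ρ (e k))) : H →L[ℂ] H) :=
          tsum_congr fun k => by
            rw [traceNorm_of_nonneg e (hΦ.nonneg_apply_ketBra _)]
            rfl
      _ ≤ ∑' k, C * ‖CFC.sqrt ρ (e k)‖ₑ ^ 2 :=
          ENNReal.tsum_le_tsum fun k => by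
            rw [← traceNorm_ketBra_self]
            exact hC (ketBra (CFC.sqrt ρ (e k)) (CFC.sqrt ρ (e k)))
      _ = C * traceNorm ρ := by
          rw [ENNReal.tsum_mul_left, ← hsSq_eq_tsum, traceNorm_eq_hsSq, CFC.abs_of_nonneg ρ hρ0]
      _ < ⊤ := ENNReal.mul_lt_top ENNReal.coe_lt_top hρ.isTraceClass
  refine (ENNReal.summable_toReal hfin.ne).congr fun p => ?_
  rw [ENNReal.toReal_ofReal (choiMatrix_self_re_nonneg e ρ hΦ p)]

theorem exists_isRhoChoi (e : HilbertBasis ι ℂ H) {ρ : H →L[ℂ] H} (hρ : IsState ρ)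
    {Φs : L1 H →ₗ[ℂ] L1 H} (hΦ : IsBoundedCP Φs) : ∃ J, IsRhoChoi e ρ Φs J := by
  simp only [isRhoChoi_iff]
  refine (tmulBasis e).exists_clm_of_matrix (choiMatrix e ρ Φs) ?_
  have hd := summable_choiMatrix_diag e hρ hΦ
  refine Summable.of_nonneg_of_le (fun _ => by positivity)
    (fun p => norm_sq_choiMatrix_le e ρ hΦ p.1 p.2) ?_
  exact hd.mul_of_nonneg hd (choiMatrix_self_re_nonneg e ρ hΦ) (choiMatrix_self_re_nonneg e ρ hΦ)

theorem isRhoChoi_rhoChoi (e : HilbertBasis ι ℂ H) {ρ : H →L[ℂ] H} (hρ : IsState ρ)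
    {Φs : L1 H →ₗ[ℂ] L1 H} (hΦ : IsBoundedCP Φs) : IsRhoChoi e ρ Φs (rhoChoi e ρ Φs) := by
  have h := exists_isRhoChoi e hρ hΦ
  rw [rhoChoi, dif_pos h]
  exact h.choose_spec

theorem IsRhoChoi.unique {e : HilbertBasis ι ℂ H} {ρ : H →L[ℂ] H} {Φs : L1 H →ₗ[ℂ] L1 H}
    {J J' : HTensor H →L[ℂ] HTensor H} (h : IsRhoChoi e ρ Φs J) (h' : IsRhoChoi e ρ Φs J') :
    J = J' :=
  (tmulBasis e).clm_ext fun p q => by rw [isRhoChoi_iff.mp h, isRhoChoi_iff.mp h']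

end Choi

/-! ### The reversing operation and the KMS duality -/

section Reversing

variable {H : Type*} [NormedAddCommGroup H] [InnerProductSpace ℂ H]

/-- Anti-unitary operators conjugate inner products, by polarization. -/
theorem inner_map_map_antiunitary (θ : H ≃ₗᵢ⋆[ℂ] H) (u v : H) : ⟪θ u, θ v⟫_ℂ = ⟪v, u⟫_ℂ := by
  have h1 : ‖θ u - Complex.I • θ v‖ = ‖u + Complex.I • v‖ := by
    rw [← θ.norm_map (u + Complex.I • v), map_add, LinearIsometryEquiv.map_smulₛₗ, Complex.conj_I,
      neg_smul, sub_eq_add_neg]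
  have h2 : ‖θ u + Complex.I • θ v‖ = ‖u - Complex.I • v‖ := by
    rw [← θ.norm_map (u - Complex.I • v), map_sub, LinearIsometryEquiv.map_smulₛₗ, Complex.conj_I,
      neg_smul, sub_neg_eq_add]
  rw [← inner_conj_symm v u, inner_eq_sum_norm_sq_div_four, inner_eq_sum_norm_sq_div_four u v,
    ← map_add, ← map_sub, θ.norm_map, θ.norm_map]
  simp only [RCLike.I_to_complex]
  rw [h1, h2]
  have h4 : (starRingEnd ℂ) 4 = 4 := map_ofNat _ 4
  simp [h4]
  ring

variable [CompleteSpace H] {ι : Type*} {e : HilbertBasis ι ℂ H} {θ : H ≃ₗᵢ⋆[ℂ] H} {ρ : H →L[ℂ] H}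

theorem reversing_apply (x : H →L[ℂ] H) (v : H) : reversing θ x v = θ (star x (θ v)) := rfl

theorem antiunitary_involutive (hθ : ∀ i, θ (e i) = e i) (v : H) : θ (θ v) = v := by
  have h : reversing θ 1 = 1 := e.clm_ext fun i j => by simp [reversing_apply, hθ]
  simpa [reversing_apply] using congrArg (fun T : H →L[ℂ] H => T v) h

/-- If an anti-unitary involution commutes with a positive `ρ` then it commutes with `√ρ`, as
`θ √ρ θ` is a positive square root of `ρ`. -/
theorem antiunitary_sqrt_comm (hθ : ∀ v, θ (θ v) = v) (hρ : 0 ≤ ρ)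
    (hc : ∀ u, θ (ρ u) = ρ (θ u)) (u : H) : θ (CFC.sqrt ρ u) = CFC.sqrt ρ (θ u) := by
  have hs : star (CFC.sqrt ρ) = CFC.sqrt ρ := (IsSelfAdjoint.of_nonneg (CFC.sqrt_nonneg ρ)).star_eq
  have hpos := (ContinuousLinearMap.nonneg_iff_isPositive _).mp (CFC.sqrt_nonneg ρ)
  have h : CFC.sqrt ρ = reversing θ (CFC.sqrt ρ) := by
    refine CFC.sqrt_unique ?_ ?_
    · ext v
      rw [mul_apply_eq_comp, reversing_apply, reversing_apply, hs, hθ,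
        ← mul_apply_eq_comp (CFC.sqrt ρ), CFC.sqrt_mul_sqrt_self ρ hρ, hc, hθ]
    · rw [ContinuousLinearMap.nonneg_iff_isPositive, ContinuousLinearMap.isPositive_iff_complex]
      intro v
      have : ⟪reversing θ (CFC.sqrt ρ) v, v⟫_ℂ = ⟪θ v, CFC.sqrt ρ (θ v)⟫_ℂ := by
        conv_lhs => rw [reversing_apply, hs, ← hθ v, inner_map_map_antiunitary, hθ]
      rw [this]
      have h0 := hpos.inner_nonneg_right (θ v)
      obtain ⟨h1, h2⟩ := Complex.nonneg_iff.mp h0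
      exact ⟨Complex.ext rfl h2, h1⟩
  conv_rhs => rw [h, reversing_apply, hs, hθ]

/-- `Θ` exchanges the matrix units, being the transposition in the basis fixed by `θ`. -/
theorem reversing_ketBra (hθ : ∀ i, θ (e i) = e i) (i j : ι) :
    reversing θ (ketBra (e i) (e j) : H →L[ℂ] H) = (ketBra (e j) (e i) : H →L[ℂ] H) := by
  ext v
  have hstar : star (ketBra (e i) (e j) : H →L[ℂ] H) = (ketBra (e j) (e i) : H →L[ℂ] H) := by
    rw [ContinuousLinearMap.star_eq_adjoint]
    exact InnerProductSpace.adjoint_rankOne _ _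
  rw [reversing_apply, hstar, ketBra_apply, ketBra_apply, LinearIsometryEquiv.map_smulₛₗ, hθ,
    inner_conj_symm]
  conv_lhs => rw [← hθ i, inner_map_map_antiunitary]

theorem sqrt_mul_ketBra_mul_sqrt (a b : H) :
    CFC.sqrt ρ * (ketBra a b : H →L[ℂ] H) * CFC.sqrt ρ =
      (ketBra (CFC.sqrt ρ a) (CFC.sqrt ρ b) : H →L[ℂ] H) := by
  have hs : star (CFC.sqrt ρ) = CFC.sqrt ρ := (IsSelfAdjoint.of_nonneg (CFC.sqrt_nonneg ρ)).star_eq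
  ext v
  rw [mul_apply_eq_comp, mul_apply_eq_comp, ketBra_apply, ketBra_apply, map_smul,
    ← ContinuousLinearMap.adjoint_inner_left, ← ContinuousLinearMap.star_eq_adjoint, hs]

/-- `√ρ Θ(w) √ρ` is the transpose of `√ρ w √ρ` in the basis fixed by `θ`. -/
theorem inner_sqrt_mul_reversing_mul_sqrt (hθ : ∀ i, θ (e i) = e i) (hρ : 0 ≤ ρ)
    (hc : ∀ u, θ (ρ u) = ρ (θ u)) (w : H →L[ℂ] H) (i j : ι) :
    ⟪e i, (CFC.sqrt ρ * reversing θ w * CFC.sqrt ρ) (e j)⟫_ℂ =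
      ⟪CFC.sqrt ρ (e j), w (CFC.sqrt ρ (e i))⟫_ℂ := by
  have hs : star (CFC.sqrt ρ) = CFC.sqrt ρ := (IsSelfAdjoint.of_nonneg (CFC.sqrt_nonneg ρ)).star_eq
  have hfix : ∀ k, θ (CFC.sqrt ρ (e k)) = CFC.sqrt ρ (e k) := fun k => by
    rw [antiunitary_sqrt_comm (antiunitary_involutive hθ) hρ hc, hθ]
  rw [mul_apply_eq_comp, mul_apply_eq_comp, ← ContinuousLinearMap.adjoint_inner_left,
    ← ContinuousLinearMap.star_eq_adjoint, hs, reversing_apply, hfix]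
  conv_lhs => rw [← hfix i, inner_map_map_antiunitary]
  rw [ContinuousLinearMap.star_eq_adjoint, ContinuousLinearMap.adjoint_inner_left]

/-- In matrix units, the `Θ`-KMS duality says that the Choi matrix of `ΦsΘ` is that of `Φs` with
the two tensor factors exchanged. -/
theorem choiMatrix_thetaKMSAdjoint (hθ : ∀ i, θ (e i) = e i) (hρ : 0 ≤ ρ)
    (hc : ∀ u, θ (ρ u) = ρ (θ u)) {Φs ΦsΘ : L1 H →ₗ[ℂ] L1 H}
    {Φ ΦΘ : (H →L[ℂ] H) →ₗ[ℂ] (H →L[ℂ] H)} (hd : IsDualMap Φs Φ) (hdΘ : IsDualMap ΦsΘ ΦΘ)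
    (hKMS : IsThetaKMSAdjoint θ ρ Φ ΦΘ) (p q : ι × ι) :
    choiMatrix e ρ ΦsΘ p q = choiMatrix e ρ Φs p.swap q.swap := by
  obtain ⟨k, l⟩ := p
  obtain ⟨k', l'⟩ := q
  have h := hKMS (star (ketBra (e l') (e l) : H →L[ℂ] H)) (ketBra (e k') (e k) : H →L[ℂ] H)
  rw [star_star, reversing_ketBra hθ, sqrt_mul_ketBra_mul_sqrt, ← hd, trace_mul_ketBra,
    trace_mul_ketBra, inner_sqrt_mul_reversing_mul_sqrt hθ hρ hc, ← trace_ketBra_mul (ΦΘ _), ← hdΘ,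
    trace_mul_ketBra] at h
  exact h.symm

theorem IsRhoChoi.flip_conj {Φs ΦsΘ : L1 H →ₗ[ℂ] L1 H} {J : HTensor H →L[ℂ] HTensor H}
    (hJ : IsRhoChoi e ρ Φs J)
    (h : ∀ p q, choiMatrix e ρ ΦsΘ p q = choiMatrix e ρ Φs p.swap q.swap) :
    IsRhoChoi e ρ ΦsΘ (flip H * J * flip H) := by
  rw [isRhoChoi_iff] at hJ ⊢
  intro p q
  have hflip : ∀ p, flip H (tmulBasis e p) = tmulBasis e p.swap := fun p => by
    rw [tmulBasis_apply, tmulBasis_apply, flip_tmul]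
    rfl
  rw [h, mul_apply_eq_comp, mul_apply_eq_comp, ← inner_flip_left, hflip, hflip, hJ]

end Reversing

end ChoiFlip

theorem mainTheorem7 {H : Type*} [NormedAddCommGroup H] [InnerProductSpace ℂ H] [CompleteSpace H]
    [TopologicalSpace.SeparableSpace H] :
    (∀ x : ChoiFlip.HTensor H →L[ℂ] ChoiFlip.HTensor H,
      ChoiFlip.IsTraceClass x → ChoiFlip.StrictlyPositive x →
        ChoiFlip.IsTraceClass (ChoiFlip.flip H * x * ChoiFlip.flip H) ∧
        ChoiFlip.StrictlyPositive (ChoiFlip.flip H * x * ChoiFlip.flip H) ∧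
        IsSelfAdjoint (ChoiFlip.opLog (ChoiFlip.flip H * x * ChoiFlip.flip H)) ∧
        ChoiFlip.opLog (ChoiFlip.flip H * x * ChoiFlip.flip H) =
          ChoiFlip.sandwich (ChoiFlip.flip H) (ChoiFlip.opLog x)) ∧
    (∀ {ι : Type*} (e : HilbertBasis ι ℂ H) (θ : H ≃ₗᵢ⋆[ℂ] H) (ρ : H →L[ℂ] H),
      (∀ i, θ (e i) = e i) → ChoiFlip.IsState ρ → (∀ u, θ (ρ u) = ρ (θ u)) →
      ∀ (Φs ΦsΘ : ChoiFlip.L1 H →ₗ[ℂ] ChoiFlip.L1 H)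
        (Φ ΦΘ : (H →L[ℂ] H) →ₗ[ℂ] (H →L[ℂ] H)),
        ChoiFlip.IsBoundedCP Φs → ChoiFlip.IsBoundedCP ΦsΘ →
        ChoiFlip.IsDualMap Φs Φ → ChoiFlip.IsDualMap ΦsΘ ΦΘ →
        ChoiFlip.IsThetaKMSAdjoint θ ρ Φ ΦΘ →
          ChoiFlip.IsRhoChoi e ρ Φs (ChoiFlip.rhoChoi e ρ Φs) ∧
          ChoiFlip.IsRhoChoi e ρ ΦsΘ (ChoiFlip.rhoChoi e ρ ΦsΘ) ∧
          ChoiFlip.rhoChoi e ρ ΦsΘ =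
            ChoiFlip.flip H * ChoiFlip.rhoChoi e ρ Φs * ChoiFlip.flip H) := by
  open ChoiFlip in
  refine ⟨fun x hx hpos => ?_, fun e θ ρ hθ hρ hc Φs ΦsΘ Φ ΦΘ hΦ hΦΘ hd hdΘ hKMS => ?_⟩
  · have htc := hx.mul_mul (ChoiFlip.flip H) (ChoiFlip.flip H)
    have hpos' := hpos.conj_involution flip_mul_flip isSelfAdjoint_flip
    exact ⟨htc, hpos', isSelfAdjoint_opLog htc.isCompactOperator hpos'.1.isSymmetric,
      opLog_conj_involution flip_mul_flip isSelfAdjoint_flip x⟩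
  · have hJ := isRhoChoi_rhoChoi e hρ hΦ
    have hJΘ := isRhoChoi_rhoChoi e hρ hΦΘ
    have hρ0 : 0 ≤ ρ := (ContinuousLinearMap.nonneg_iff_isPositive ρ).mpr hρ.isPositive
    exact ⟨hJ, hJΘ, hJΘ.unique
      (hJ.flip_conj (choiMatrix_thetaKMSAdjoint hθ hρ0 hc hd hdΘ hKMS))⟩
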